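/- Notation. Let $\mathbb{N}=\{1,2,3,\dots\}$ and, for a positive integer $a$, let $\mathbb{N}_a=\{n\in\mathbb{N}\mid \gcd(a,n)=1\}$. Let $\Phi_n(q)$ be the $n$-th cyclotomic polynomial and $(x;t)_k=\prod_{j=1}^{k}(1-xt^{j-1})$. For a commutative ring $R$ and $S\subset\mathbb{N}$ put $$R[q]^S:=\varprojlim_{f\in\Phi_S^*} R[q]/(f),$$ where $\Phi^*_S\subset\mathbb{Z}[q]$ is the multiplicative set generated by $\{\Phi_n(q)\mid n\in S\}$, directed by divisibility. For a positive integer $b$ put $$\mathcal S_b:=\varprojlim_k \mathbb{Z}[1/b][q]/((q;q)_k),\qquad \mathcal R_b:=\varprojlim_k \mathbb{Z}[1/b][q]/((q;q^2)_k).$$ For a prime $p$ put $$\mathcal S_b^{p,0}:=\mathbb{Z}[1/b][q]^{\mathbb{N}_p},\quad \mathcal S_b^{p,\bar 0}:=\prod_{j>0}\mathbb{Z}[1/b][q]^{p^j\mathbb{N}_p},\quad \mathcal S_{p,j}:=\mathbb{Z}[1/p][q]^{p^j\mathbb{N}_p}\ (j\ge 0),$$ $$\mathcal R_b^{p,0}:=\mathbb{Z}[1/b][q]^{\mathbb{N}_{2p}},\quad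 \mathcal R_b^{p,\bar 0}:=\prod_{j>0}\mathbb{Z}[1/b][q]^{p^j\mathbb{N}_{2p}}.$$ All maps below are the natural ones between inverse limits, i.e. those induced by the projections $\mathbb{Z}[1/b][q]/(g)\to\mathbb{Z}[1/b][q]/(f)$ for $f\mid g$. Proposition. Let $b$ be a positive integer. (1) For every prime divisor $p$ of $b$, the natural map $\mathcal S_b\to\mathcal S_b^{p,0}\times\mathcal S_b^{p,\bar 0}$ is a ring isomorphism. In particular, for every prime $p$, the natural map $\mathcal S_p\to\prod_{j\ge 0}\mathcal S_{p,j}$ is a ring isomorphism. (2) For every odd prime divisor $p$ of $b$, the natural map $\mathcal R_b\to\mathcal R_b^{p,0}\times\mathcal R_b^{p,\bar 0}$ is a ring isomorphism. If $2\mid b$, then the natural map $\mathcal R_b\to\mathcal R_b^{2,0}$ is a ring isomorphism. (3) If $b$ is odd, the natural ring homomorphism $\mathcal S_b\to\mathcal R_b$ is injective. (4) If $2\mid b$, the natural ring homomorphism $\mathcal S_b^{2,0}\to\mathcal R_b$ is an isomorphism. -/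

import Mathlib

open Polynomial

noncomputable section

namespace CycComp

section InverseLimit

variable {A ι κ τ : Type} [CommRing A] [Preorder ι] [Preorder κ] [Preorder τ]

/-- The inverse limit of the quotient rings `A / I i` along the canonical projections
`A / I j → A / I i` for `i ≤ j`, where `I` is a decreasing family of ideals of `A`. -/
def invLim (I : ι → Ideal A) (hI : Antitone I) : Subring (∀ i, A ⧸ I i) where
  carrier := {x | ∀ (i j : ι) (h : i ≤ j), Ideal.Quotient.factor (hI h) (x j) = x i}
  mul_mem' hx hy i j h := by simp [hx i j h, hy i j h]
  one_mem' i j h := by simp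
  add_mem' hx hy i j h := by simp [hx i j h, hy i j h]
  zero_mem' i j h := by simp
  neg_mem' hx i j h := by simp [hx i j h]

theorem factor_comm {I J K L : Ideal A} (h1 : I ≤ J) (h2 : J ≤ L) (h3 : I ≤ K) (h4 : K ≤ L)
    (x : A ⧸ I) :
    Ideal.Quotient.factor h2 (Ideal.Quotient.factor h1 x) =
      Ideal.Quotient.factor h4 (Ideal.Quotient.factor h3 x) := by
  obtain ⟨a, rfl⟩ := Ideal.Quotient.mk_surjective x
  simp

theorem factor_eq_factor [IsDirectedOrder ι] {I : ι → Ideal A} {hI : Antitone I}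
    (x : invLim I hI) {L : Ideal A} {i i' : ι} (h : I i ≤ L) (h' : I i' ≤ L) :
    Ideal.Quotient.factor h (x.1 i) = Ideal.Quotient.factor h' (x.1 i') := by
  obtain ⟨m, hm, hm'⟩ := exists_ge_ge i i'
  rw [← x.2 i m hm, ← x.2 i' m hm']
  exact factor_comm _ _ _ _ _

/-- The natural map `lim A / I i → lim A / J j`, induced by the projections `A / I i → A / J j`
for `I i ≤ J j`. It exists as soon as every `J j` contains some `I i`, and the choice of `i` does
not matter, see `invLimMap_apply`. -/
def invLimMap [IsDirectedOrder ι] {I : ι → Ideal A} (hI : Antitone I) {J : κ → Ideal A}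
    (hJ : Antitone J) (h : ∀ j, ∃ i, I i ≤ J j) : invLim I hI →+* invLim J hJ where
  toFun x := ⟨fun j => Ideal.Quotient.factor (h j).choose_spec (x.1 (h j).choose), by
    intro j j' hj
    exact (Ideal.Quotient.factor_comp_apply _ _ _).trans
      (factor_eq_factor x ((h j').choose_spec.trans (hJ hj)) (h j).choose_spec)⟩
  map_one' := by ext j; simp
  map_zero' := by ext j; simp
  map_add' x y := by ext j; simp
  map_mul' x y := by ext j; simp

theorem invLimMap_apply [IsDirectedOrder ι] {I : ι → Ideal A} (hI : Antitone I)
    {J : κ → Ideal A} (hJ : Antitone J) (h : ∀ j, ∃ i, I i ≤ J j) (x : invLim I hI)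
    {i : ι} {j : κ} (hij : I i ≤ J j) :
    (invLimMap hI hJ h x).1 j = Ideal.Quotient.factor hij (x.1 i) :=
  factor_eq_factor x _ _

theorem invLimMap_comp [IsDirectedOrder ι] [IsDirectedOrder κ] {I : ι → Ideal A}
    (hI : Antitone I) {J : κ → Ideal A} (hJ : Antitone J) {K : τ → Ideal A} (hK : Antitone K)
    (h : ∀ j, ∃ i, I i ≤ J j) (h' : ∀ l, ∃ j, J j ≤ K l) (h'' : ∀ l, ∃ i, I i ≤ K l) :
    (invLimMap hJ hK h').comp (invLimMap hI hJ h) = invLimMap hI hK h'' := by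
  ext x l
  obtain ⟨j, hj⟩ := h' l
  obtain ⟨i, hi⟩ := h j
  rw [RingHom.comp_apply, invLimMap_apply hJ hK h' _ hj, invLimMap_apply hI hJ h _ hi,
    invLimMap_apply hI hK h'' _ (hi.trans hj), Ideal.Quotient.factor_comp_apply]

end InverseLimit

section Completion

/-- The multiplicative set in `ℤ[q]` generated by the cyclotomic polynomials `Φ_n`, `n ∈ S`. -/
def PhiStar (S : Set ℕ) : Type :=
  ↥(Submonoid.closure ((fun n => cyclotomic n ℤ) '' S) : Submonoid ℤ[X])

/-- `PhiStar S` is directed with respect to divisibility in `ℤ[q]`. -/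
instance (S : Set ℕ) : Preorder (PhiStar S) where
  le f g := f.1 ∣ g.1
  le_refl f := dvd_refl f.1
  le_trans _ _ _ := dvd_trans

instance (S : Set ℕ) : IsDirectedOrder (PhiStar S) :=
  ⟨fun f g => ⟨⟨f.1 * g.1, mul_mem f.2 g.2⟩, Dvd.intro _ rfl, Dvd.intro_left _ rfl⟩⟩

/-- The ideal of `R[q]` generated by an element `f` of `PhiStar S`. -/
def phiIdeal (R : Type) [CommRing R] (S : Set ℕ) (f : PhiStar S) : Ideal R[X] :=
  Ideal.span {f.1.map (Int.castRingHom R)}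

theorem phiIdeal_antitone (R : Type) [CommRing R] (S : Set ℕ) : Antitone (phiIdeal R S) :=
  fun _ _ h => Ideal.span_singleton_le_span_singleton.2 (Polynomial.map_dvd _ h)

/-- The `S`-cyclotomic completion `R[q]^S`. -/
abbrev Completion (R : Type) [CommRing R] (S : Set ℕ) : Type :=
  invLim (phiIdeal R S) (phiIdeal_antitone R S)

/-- The natural map `ρ_{S,S'} : R[q]^S → R[q]^{S'}` for `S' ⊆ S`. -/
def rho (R : Type) [CommRing R] {S S' : Set ℕ} (h : S' ⊆ S) :
    Completion R S →+* Completion R S' :=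
  invLimMap (phiIdeal_antitone R S) (phiIdeal_antitone R S') fun f =>
    ⟨⟨f.1, Submonoid.closure_mono (Set.image_mono h) f.2⟩, le_rfl⟩

/-- `(x; t)_k = ∏_{j=1}^{k} (1 - x t^{j-1})`. -/
def qPoch {A : Type} [CommRing A] (x t : A) (k : ℕ) : A :=
  ∏ j ∈ Finset.range k, (1 - x * t ^ j)

/-- The ideal generated by `(q; q)_k` in `R[q]`. -/
def sIdeal (R : Type) [CommRing R] (k : ℕ) : Ideal R[X] := Ideal.span {qPoch X X k}

/-- The ideal generated by `(q; q²)_k` in `R[q]`. -/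
def rIdeal (R : Type) [CommRing R] (k : ℕ) : Ideal R[X] := Ideal.span {qPoch X (X ^ 2) k}

theorem qPoch_dvd {A : Type} [CommRing A] (x t : A) {k m : ℕ} (h : k ≤ m) :
    qPoch x t k ∣ qPoch x t m :=
  Finset.prod_dvd_prod_of_subset _ _ _ (Finset.range_mono h)

theorem sIdeal_antitone (R : Type) [CommRing R] : Antitone (sIdeal R) :=
  fun _ _ h => Ideal.span_singleton_le_span_singleton.2 (qPoch_dvd _ _ h)

theorem rIdeal_antitone (R : Type) [CommRing R] : Antitone (rIdeal R) :=
  fun _ _ h => Ideal.span_singleton_le_span_singleton.2 (qPoch_dvd _ _ h)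

theorem exists_dvd_qPoch {R : Type} [CommRing R] {S : Set ℕ} (x t : R[X])
    (H : ∀ n ∈ S, ∀ k, ∃ j, k ≤ j ∧ cyclotomic n R ∣ 1 - x * t ^ j) (f : PhiStar S) :
    ∃ k, f.1.map (Int.castRingHom R) ∣ qPoch x t k := by
  suffices h : ∀ k, ∃ m, qPoch x t k * f.1.map (Int.castRingHom R) ∣ qPoch x t m by
    obtain ⟨m, hm⟩ := h 0
    exact ⟨m, (Dvd.intro_left _ rfl).trans hm⟩
  obtain ⟨f, hf⟩ := f
  induction hf using Submonoid.closure_induction with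
  | mem y hy =>
    obtain ⟨n, hn, rfl⟩ := hy
    intro k
    obtain ⟨j, hkj, hj⟩ := H n hn k
    refine ⟨j + 1, ?_⟩
    simp only [map_cyclotomic]
    rw [show qPoch x t (j + 1) = qPoch x t j * (1 - x * t ^ j) from Finset.prod_range_succ _ _]
    exact mul_dvd_mul (qPoch_dvd _ _ hkj) hj
  | one => exact fun k => ⟨k, by simp⟩
  | mul a c _ _ iha ihc =>
    intro k
    obtain ⟨m, hm⟩ := iha k
    obtain ⟨l, hl⟩ := ihc m
    refine ⟨l, ?_⟩
    simp only [Polynomial.map_mul] at hm hl ⊢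
    rw [← mul_assoc]
    exact (mul_dvd_mul_right hm _).trans hl

theorem cyclotomic_dvd_one_sub {R : Type} [CommRing R] {n m : ℕ} (h : n ∣ m) :
    cyclotomic n R ∣ 1 - X ^ m := by
  rw [← neg_sub, dvd_neg]
  obtain ⟨c, rfl⟩ := h
  refine (cyclotomic.dvd_X_pow_sub_one n R).trans ?_
  rw [pow_mul]
  simpa using sub_dvd_pow_sub_pow ((X : R[X]) ^ n) 1 c

theorem exists_sIdeal_le (R : Type) [CommRing R] (S : Set ℕ) (f : PhiStar S) :
    ∃ k, sIdeal R k ≤ phiIdeal R S f := by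
  obtain ⟨k, hk⟩ := exists_dvd_qPoch (R := R) X X (fun n _ k => by
    rcases Nat.eq_zero_or_pos n with rfl | hn
    · exact ⟨k, le_rfl, by simp⟩
    · refine ⟨n * (k + 1) - 1, ?_, ?_⟩
      · have := Nat.le_mul_of_pos_left (k + 1) hn
        omega
      · rw [← pow_succ', Nat.sub_add_cancel (Nat.mul_pos hn (Nat.succ_pos k))]
        exact cyclotomic_dvd_one_sub (Dvd.intro _ rfl)) f
  exact ⟨k, Ideal.span_singleton_le_span_singleton.2 hk⟩

theorem exists_rIdeal_le (R : Type) [CommRing R] (S : Set ℕ) (hS : ∀ n ∈ S, Odd n)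
    (f : PhiStar S) : ∃ k, rIdeal R k ≤ phiIdeal R S f := by
  obtain ⟨k, hk⟩ := exists_dvd_qPoch (R := R) X (X ^ 2) (fun n hn k => by
    obtain ⟨a, rfl⟩ := hS n hn
    refine ⟨a * (2 * k + 1) + k, Nat.le_add_left _ _, ?_⟩
    rw [← pow_mul, ← pow_succ']
    exact cyclotomic_dvd_one_sub ⟨2 * k + 1, by ring⟩) f
  exact ⟨k, Ideal.span_singleton_le_span_singleton.2 hk⟩

theorem exists_sIdeal_le_rIdeal (R : Type) [CommRing R] (k : ℕ) :
    ∃ m, sIdeal R m ≤ rIdeal R k := by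
  refine ⟨2 * k, Ideal.span_singleton_le_span_singleton.2 ?_⟩
  induction k with
  | zero => simp [qPoch]
  | succ k ih =>
    rw [show 2 * (k + 1) = 2 * k + 1 + 1 by ring]
    simp only [qPoch, Finset.prod_range_succ] at ih ⊢
    rw [mul_assoc, ← pow_mul]
    exact mul_dvd_mul ih (Dvd.intro _ rfl)

end Completion

/-- `ℕ_a`: the positive integers coprime to `a`. -/
def coprimeTo (a : ℕ) : Set ℕ := {n | 0 < n ∧ Nat.Coprime a n}

/-- The set `c · S` of all multiples `c m`, `m ∈ S`. -/
def dilate (c : ℕ) (S : Set ℕ) : Set ℕ := (fun m => c * m) '' S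

theorem odd_of_mem_coprimeTo_two_mul {a n : ℕ} (h : n ∈ coprimeTo (2 * a)) : Odd n :=
  Nat.coprime_two_left.1 (Nat.Coprime.coprime_mul_right h.2)

theorem exists_phiIdeal_le_rIdeal (R : Type) [CommRing R] (k : ℕ) :
    ∃ f, phiIdeal R (coprimeTo 2) f ≤ rIdeal R k := by
  have hmem : (∏ j ∈ Finset.range k, ∏ d ∈ (2 * j + 1).divisors, cyclotomic d ℤ) ∈
      Submonoid.closure ((fun n => cyclotomic n ℤ) '' coprimeTo 2) := by
    refine Submonoid.prod_mem _ fun j _ => Submonoid.prod_mem _ fun d hd => ?_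
    refine Submonoid.subset_closure ⟨d, ⟨Nat.pos_of_mem_divisors hd, ?_⟩, rfl⟩
    exact Nat.coprime_two_left.2
      (Odd.of_dvd_nat ⟨j, rfl⟩ (Nat.dvd_of_mem_divisors hd))
  refine ⟨⟨_, hmem⟩, Ideal.span_singleton_le_span_singleton.2 ?_⟩
  rw [Polynomial.map_prod]
  refine Finset.prod_dvd_prod_of_dvd _ _ fun j _ => ?_
  rw [prod_cyclotomic_eq_X_pow_sub_one (Nat.succ_pos _), ← pow_mul, ← pow_succ', ← neg_sub,
    neg_dvd]
  simp

section Rings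

/-- The ring `ℤ[1/b]`. -/
abbrev ZInv (b : ℕ) : Type := Localization.Away (b : ℤ)

/-- `𝒮_b = lim_k ℤ[1/b][q] / ((q; q)_k)`. -/
abbrev SRing (b : ℕ) : Type := invLim (sIdeal (ZInv b)) (sIdeal_antitone (ZInv b))

/-- `ℛ_b = lim_k ℤ[1/b][q] / ((q; q²)_k)`. -/
abbrev RRing (b : ℕ) : Type := invLim (rIdeal (ZInv b)) (rIdeal_antitone (ZInv b))

/-- The natural map `𝒮_b → ℤ[1/b][q]^S`, for any set `S`. -/
def sToCompletion (b : ℕ) (S : Set ℕ) : SRing b →+* Completion (ZInv b) S :=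
  invLimMap (sIdeal_antitone _) (phiIdeal_antitone _ S) (exists_sIdeal_le _ S)

/-- The natural map `ℛ_b → ℤ[1/b][q]^S`, for any set `S` of odd numbers. -/
def rToCompletion (b : ℕ) (S : Set ℕ) (hS : ∀ n ∈ S, Odd n) :
    RRing b →+* Completion (ZInv b) S :=
  invLimMap (rIdeal_antitone _) (phiIdeal_antitone _ S) (exists_rIdeal_le _ S hS)

/-- The natural map `𝒮_b → ℛ_b`. -/
def sToR (b : ℕ) : SRing b →+* RRing b :=
  invLimMap (sIdeal_antitone _) (rIdeal_antitone _) (exists_sIdeal_le_rIdeal _)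

/-- `𝒮_b^{p,0} = ℤ[1/b][q]^{ℕ_p}`. -/
abbrev SZero (b p : ℕ) : Type := Completion (ZInv b) (coprimeTo p)

/-- `𝒮_b^{p,0̄} = ∏_{j>0} ℤ[1/b][q]^{p^j ℕ_p}`. -/
abbrev SBar (b p : ℕ) : Type := ∀ j : ℕ+, Completion (ZInv b) (dilate (p ^ (j : ℕ)) (coprimeTo p))

/-- `𝒮_{p,j} = ℤ[1/p][q]^{p^j ℕ_p}`. -/
abbrev SComp (p j : ℕ) : Type := Completion (ZInv p) (dilate (p ^ j) (coprimeTo p))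

/-- `ℛ_b^{p,0} = ℤ[1/b][q]^{ℕ_{2p}}`. -/
abbrev RZero (b p : ℕ) : Type := Completion (ZInv b) (coprimeTo (2 * p))

/-- `ℛ_b^{p,0̄} = ∏_{j>0} ℤ[1/b][q]^{p^j ℕ_{2p}}`. -/
abbrev RBar (b p : ℕ) : Type :=
  ∀ j : ℕ+, Completion (ZInv b) (dilate (p ^ (j : ℕ)) (coprimeTo (2 * p)))

/-- The canonical projection `𝒮_b → 𝒮_b^{p,0}`. -/
def piSZero (b p : ℕ) : SRing b →+* SZero b p := sToCompletion b _

/-- The canonical projection `𝒮_b → 𝒮_b^{p,0̄}`. -/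
def piSBar (b p : ℕ) : SRing b →+* SBar b p := RingHom.pi fun _ => sToCompletion b _

/-- The canonical projection `π_j : 𝒮_p → 𝒮_{p,j}`. -/
def piSComp (p j : ℕ) : SRing p →+* SComp p j := sToCompletion p _

/-- The canonical projection `ℛ_b → ℛ_b^{p,0}`. -/
def piRZero (b p : ℕ) : RRing b →+* RZero b p :=
  rToCompletion b _ fun _ => odd_of_mem_coprimeTo_two_mul

theorem odd_of_mem_dilate {p j n : ℕ} (hp : Odd p) (h : n ∈ dilate (p ^ j) (coprimeTo (2 * p))) :
    Odd n := by
  obtain ⟨m, hm, rfl⟩ := h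
  exact (hp.pow).mul (odd_of_mem_coprimeTo_two_mul hm)

/-- The canonical projection `ℛ_b → ℛ_b^{p,0̄}`, for odd `p`. -/
def piRBar (b p : ℕ) (hp : Odd p) : RRing b →+* RBar b p :=
  RingHom.pi fun _ => rToCompletion b _ fun _ => odd_of_mem_dilate hp

/-- The natural map `𝒮_b^{2,0} = ℤ[1/b][q]^{ℕ_2} → ℛ_b`. -/
def sZeroTwoToR (b : ℕ) : SZero b 2 →+* RRing b :=
  invLimMap (phiIdeal_antitone _ _) (rIdeal_antitone _) (exists_phiIdeal_le_rIdeal _)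

/-- `sToR` is `ρ_{ℕ,ℕ_2}`, read through the natural maps `𝒮_b → ℤ[1/b][q]^ℕ` and
`ℤ[1/b][q]^{ℕ_2} → ℛ_b`. -/
theorem sToR_eq_rho (b : ℕ) (h : coprimeTo 2 ⊆ coprimeTo 1) :
    sToR b = (sZeroTwoToR b).comp ((rho (ZInv b) h).comp (sToCompletion b (coprimeTo 1))) := by
  unfold sToR sZeroTwoToR rho sToCompletion
  rw [invLimMap_comp (h'' := exists_sIdeal_le _ _),
    invLimMap_comp (h'' := exists_sIdeal_le_rIdeal _)]

end Rings

end CycComp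

end

/-! All the rings are limits of `R[q]`, `R = ℤ[1/b]`, along products of cyclotomic polynomials. The
ideals of `(q; q)_k` are cofinal with those of all such products, and the ideals of `(q; q²)_k` with
those of products of `Φ_n`, `n` odd. This alone gives `𝒮_b^{2,0} ≅ ℛ_b` and the case `p = 2` of (2).

For the splittings, let `p` be invertible in `R`. Then `Φ_n` and `Φ_m` are comaximal in `R[q]`
whenever `n` and `m` have different `p`-adic valuations (`isCoprime_cyclotomic_of_padicValNat_lt`).
A finite product of cyclotomic polynomials meets only finitely many valuations, so the Chinese
remainder theorem at each level splits the limit into a possibly infinite product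
(`pi_invLimMap_bijective`).

For injectivity with `b` odd, Frobenius modulo 2 gives `(q; q)_k = h + 2c` with `h` a product of
`Φ_n`, `n` odd. An element dying in `ℛ_b` has `k`-th component divisible by every `h ^ s`, hence by
every `2 ^ s`. The quotient by `(q; q)_k` is free over `ℤ[1/b]`, which is 2-adically separated, so
the component vanishes. -/

namespace CycComp

/-! ### Inverse limits: cofinality and the Chinese remainder theorem -/

section InverseLimit

variable {A ι κ : Type} [CommRing A] [Preorder ι] [Preorder κ]

theorem exists_forall_mk_eq [IsDirectedOrder ι] [Nonempty ι] {I : ι → Ideal A} {hI : Antitone I}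
    (x : invLim I hI) (T : Finset ι) :
    ∃ a : A, ∀ i ∈ T, x.1 i = Ideal.Quotient.mk (I i) a := by
  obtain ⟨m, hm⟩ := T.exists_le
  obtain ⟨a, ha⟩ := Ideal.Quotient.mk_surjective (x.1 m)
  refine ⟨a, fun i hi => ?_⟩
  rw [← x.2 i m (hm i hi), ← ha, Ideal.Quotient.factor_mk]

/-- The natural map between the inverse limits of two mutually cofinal families of ideals is
bijective. -/
theorem invLimMap_bijective [IsDirectedOrder ι] [IsDirectedOrder κ] {I : ι → Ideal A}
    (hI : Antitone I) {J : κ → Ideal A} (hJ : Antitone J) (h : ∀ j, ∃ i, I i ≤ J j)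
    (h' : ∀ i, ∃ j, J j ≤ I i) : Function.Bijective (invLimMap hI hJ h) := by
  -- Both composites are natural maps from a limit to itself, hence the identity, since natural maps
  -- do not depend on the chosen indices.
  have id_of {τ : Type} [Preorder τ] [IsDirectedOrder τ] {K : τ → Ideal A} (hK : Antitone K)
      (H : ∀ i, ∃ j, K j ≤ K i) : invLimMap hK hK H = RingHom.id _ := by
    ext x i
    rw [invLimMap_apply hK hK H x (le_refl (K i))]
    obtain ⟨a, ha⟩ := Ideal.Quotient.mk_surjective (x.1 i)
    simp [← ha]
  refine Function.bijective_iff_has_inverse.2 ⟨invLimMap hJ hI h', fun x => ?_, fun x => ?_⟩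
  · rw [← RingHom.comp_apply, invLimMap_comp hI hJ hI h h' fun i => ⟨i, le_rfl⟩, id_of]
    rfl
  · rw [← RingHom.comp_apply, invLimMap_comp hJ hI hJ h' h fun i => ⟨i, le_rfl⟩, id_of]
    rfl

/-- If the families `J σ` are pairwise comaximal and every `I i` contains a finite intersection of
members of the `J σ`, one from each, then the inverse limit along `I` is the product of the inverse
limits along the `J σ`. -/
theorem pi_invLimMap_bijective {σ : Type} {κ : σ → Type} [∀ s, Preorder (κ s)]
    [∀ s, IsDirectedOrder (κ s)] [IsDirectedOrder ι] [Nonempty ι] {I : ι → Ideal A}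
    (hI : Antitone I) {J : ∀ s, κ s → Ideal A} (hJ : ∀ s, Antitone (J s))
    (h : ∀ s j, ∃ i, I i ≤ J s j)
    (hcop : ∀ s t, s ≠ t → ∀ j j', IsCoprime (J s j) (J t j'))
    (hcof : ∀ i, ∃ (T : Finset σ) (f : ∀ s, κ s), T.inf (fun s => J s (f s)) ≤ I i) :
    Function.Bijective
      (RingHom.pi fun s => invLimMap hI (hJ s) (h s)) := by
  classical
  constructor
  · rw [injective_iff_map_eq_zero]
    intro x hx
    ext i
    obtain ⟨T, f, hf⟩ := hcof i
    choose g hg using fun s => h s (f s)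
    obtain ⟨a, ha⟩ := exists_forall_mk_eq x (insert i (T.image g))
    rw [ha i (Finset.mem_insert_self _ _)]
    refine Ideal.Quotient.eq_zero_iff_mem.2 (hf ?_)
    rw [Submodule.mem_finsetInf]
    intro s hs
    have h1 : (invLimMap hI (hJ s) (h s) x).1 (f s) = 0 := by
      have : invLimMap hI (hJ s) (h s) x = 0 := congrFun hx s
      rw [this]; rfl
    rw [invLimMap_apply hI (hJ s) (h s) x (hg s),
      ha (g s) (Finset.mem_insert_of_mem (Finset.mem_image_of_mem g hs)),
      Ideal.Quotient.factor_mk] at h1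
    exact Ideal.Quotient.eq_zero_iff_mem.1 h1
  · intro y
    have crt (T : Finset σ) (f : ∀ s, κ s) :
        ∃ a : A, ∀ s ∈ T, Ideal.Quotient.mk (J s (f s)) a = (y s).1 (f s) := by
      choose c hc using fun s => Ideal.Quotient.mk_surjective ((y s).1 (f s))
      obtain ⟨a, ha⟩ := Ideal.exists_forall_sub_mem_ideal (I := fun s : T => J s (f s))
        (fun s t hst => hcop s t (Subtype.coe_ne_coe.2 hst) _ _) fun s => c s
      exact ⟨a, fun s hs => by rw [← hc s]; exact Ideal.Quotient.eq.2 (ha ⟨s, hs⟩)⟩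
    have proj {s} {j j' : κ s} (hj : j ≤ j') {a : A}
        (ha : Ideal.Quotient.mk (J s j') a = (y s).1 j') :
        Ideal.Quotient.mk (J s j) a = (y s).1 j := by
      rw [← (y s).2 j j' hj, ← ha, Ideal.Quotient.factor_mk]
    choose T f hf using hcof
    choose a ha using fun i => crt (T i) (f i)
    have compat (i i' : ι) (hii : i ≤ i') :
        Ideal.Quotient.mk (I i) (a i') = Ideal.Quotient.mk (I i) (a i) := by
      -- A lift `c` at a common refinement of both choices agrees with `a i` modulo `I i` and with
      -- `a i'` modulo `I i'`.
      choose m hm hm' using fun s => exists_ge_ge (f i s) (f i' s)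
      obtain ⟨c, hc⟩ := crt (T i ∪ T i') m
      have h1 : c - a i ∈ I i := hf i <| by
        rw [Submodule.mem_finsetInf]
        intro s hs
        rw [← Ideal.Quotient.eq, ha i s hs]
        exact proj (hm s) (hc s (Finset.mem_union_left _ hs))
      have h2 : c - a i' ∈ I i' := hf i' <| by
        rw [Submodule.mem_finsetInf]
        intro s hs
        rw [← Ideal.Quotient.eq, ha i' s hs]
        exact proj (hm' s) (hc s (Finset.mem_union_right _ hs))
      rw [← Ideal.Quotient.eq.2 h1, Ideal.Quotient.eq.2 (hI hii h2)]
    refine ⟨⟨fun i => Ideal.Quotient.mk (I i) (a i), fun i i' hii => ?_⟩, ?_⟩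
    · rw [Ideal.Quotient.factor_mk, compat i i' hii]
    · funext s
      ext j
      obtain ⟨i, hi⟩ := h s j
      rw [RingHom.pi_apply, invLimMap_apply hI (hJ s) (h s) _ hi, Ideal.Quotient.factor_mk]
      -- The update forces `m s ≥ j`, so that `c` also represents `y` at `(s, j)`, even when `s ∉ T
      -- i`.
      choose m hm hm' using fun t => exists_ge_ge (f i t) (Function.update (f i) s j t)
      obtain ⟨c, hc⟩ := crt (insert s (T i)) m
      have h1 : c - a i ∈ I i := hf i <| by
        rw [Submodule.mem_finsetInf]
        intro t ht
        rw [← Ideal.Quotient.eq, ha i t ht]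
        exact proj (hm t) (hc t (Finset.mem_insert_of_mem ht))
      rw [← Ideal.Quotient.eq.2 (hi h1)]
      refine proj ?_ (hc s (Finset.mem_insert_self _ _))
      simpa using hm' s

end InverseLimit

/-! ### Comaximality of cyclotomic polynomials -/

section Cyclotomic

variable {R : Type} [CommRing R]

/-- Over `ℤ`, `(X ^ d - 1) * Φ_n` divides `X ^ n - 1`; the nonzero factor `X ^ d - 1` cancels there,
and the result is mapped to `R`. -/
theorem cyclotomic_dvd_geom_sum {n d : ℕ} (hd : d ∣ n) (hdn : d < n) :
    cyclotomic n R ∣ ∑ i ∈ Finset.range (n / d), (X ^ d) ^ i := by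
  have hn : 0 < n := (Nat.zero_le d).trans_lt hdn
  have hd0 : d ≠ 0 := by
    rintro rfl
    exact hn.ne' (zero_dvd_iff.1 hd)
  have h := X_pow_sub_one_mul_cyclotomic_dvd_X_pow_sub_one_of_dvd ℤ
    (Nat.mem_properDivisors.2 ⟨hd, hdn⟩)
  have hgeom := mul_geom_sum ((X : ℤ[X]) ^ d) (n / d)
  rw [← pow_mul, Nat.mul_div_cancel' hd] at hgeom
  rw [← hgeom] at h
  have := Polynomial.map_dvd (Int.castRingHom R)
    ((mul_dvd_mul_iff_left (by simpa using (monic_X_pow_sub_C (1 : ℤ) hd0).ne_zero)).1 h)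
  simpa [Polynomial.map_sum] using this

/-- Modulo `(Φ_n, Φ_m)` one has `X ^ gcd(n, m) = 1`, and the gcd divides `n / p` because `m` has the
smaller valuation. So `X ^ (n / p) = 1`, and the multiple `∑_{i < p} X ^ (i n / p)` of `Φ_n` becomes
`p`. Thus the unit `p` lies in the ideal. -/
theorem isCoprime_cyclotomic_of_padicValNat_lt {p n m : ℕ} (hp : p.Prime) (hpu : IsUnit (p : R))
    (hn : 0 < n) (hm : 0 < m) (h : padicValNat p m < padicValNat p n) :
    IsCoprime (cyclotomic n R) (cyclotomic m R) := by
  have := Fact.mk hp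
  set I : Ideal R[X] := Ideal.span {cyclotomic n R, cyclotomic m R} with hI
  have hnI : cyclotomic n R ∈ I := Ideal.subset_span (by simp)
  have hmI : cyclotomic m R ∈ I := Ideal.subset_span (by simp)
  rw [← Ideal.isCoprime_span_singleton_iff, Ideal.isCoprime_iff_sup_eq, ← Ideal.span_insert,
    ← hI]
  have hmem {k : ℕ} (hk : cyclotomic k R ∈ I) : (Ideal.Quotient.mk I X) ^ k = 1 := by
    rw [← map_pow, ← map_one (Ideal.Quotient.mk I)]
    exact Ideal.Quotient.eq.2 (I.mem_of_dvd (cyclotomic.dvd_X_pow_sub_one k R) hk)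
  have hgcd : (Ideal.Quotient.mk I X) ^ n.gcd m = 1 := pow_gcd_eq_one.2 ⟨hmem hnI, hmem hmI⟩
  have hpn : p ∣ n := dvd_of_one_le_padicValNat (by omega)
  have hlt : n / p < n := Nat.div_lt_self hn hp.one_lt
  have hdvd : n.gcd m ∣ n / p := by
    obtain ⟨c, hc⟩ := n.gcd_dvd_left m
    have hg0 : n.gcd m ≠ 0 := (Nat.gcd_pos_of_pos_left _ hn).ne'
    have hc0 : c ≠ 0 := by
      rintro rfl
      omega
    have hpc : p ∣ c := by
      by_contra hpc
      have h1 := congrArg (padicValNat p) hc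
      rw [padicValNat.mul hg0 hc0, padicValNat.eq_zero_of_not_dvd hpc, add_zero] at h1
      have h2 : padicValNat p (n.gcd m) ≤ padicValNat p m :=
        (padicValNat_dvd_iff_le hm.ne').1 (pow_padicValNat_dvd.trans (n.gcd_dvd_right m))
      omega
    obtain ⟨e, rfl⟩ := hpc
    refine ⟨e, Nat.div_eq_of_eq_mul_right hp.pos ?_⟩
    linarith
  have hone : (Ideal.Quotient.mk I X) ^ (n / p) = 1 := by
    obtain ⟨e, he⟩ := hdvd
    rw [he, pow_mul, hgcd, one_pow]
  have hsum := I.mem_of_dvd (cyclotomic_dvd_geom_sum (Nat.div_dvd_of_dvd hpn) hlt) hnI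
  rw [Nat.div_div_self hpn hn.ne', ← Ideal.Quotient.eq_zero_iff_mem] at hsum
  simp only [map_sum, map_pow, hone, one_pow, Finset.sum_const, Finset.card_range, nsmul_eq_mul,
    mul_one] at hsum
  rw [← map_natCast (Ideal.Quotient.mk I), Ideal.Quotient.eq_zero_iff_mem] at hsum
  exact Ideal.eq_top_of_isUnit_mem I hsum (by simpa using hpu.map (C : R →+* R[X]))

theorem isCoprime_cyclotomic_of_padicValNat_ne {p n m : ℕ} (hp : p.Prime) (hpu : IsUnit (p : R))
    (hn : 0 < n) (hm : 0 < m) (h : padicValNat p n ≠ padicValNat p m) :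
    IsCoprime (cyclotomic n R) (cyclotomic m R) := by
  rcases h.lt_or_gt with h | h
  · exact (isCoprime_cyclotomic_of_padicValNat_lt hp hpu hm hn h).symm
  · exact isCoprime_cyclotomic_of_padicValNat_lt hp hpu hn hm h

theorem isCoprime_map_of_mem_closure {S T : Set ℕ}
    (h : ∀ n ∈ S, ∀ m ∈ T, IsCoprime (cyclotomic n R) (cyclotomic m R)) {f g : ℤ[X]}
    (hf : f ∈ Submonoid.closure ((fun n => cyclotomic n ℤ) '' S))
    (hg : g ∈ Submonoid.closure ((fun n => cyclotomic n ℤ) '' T)) :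
    IsCoprime (f.map (Int.castRingHom R)) (g.map (Int.castRingHom R)) := by
  induction hf using Submonoid.closure_induction with
  | mem y hy =>
    obtain ⟨n, hn, rfl⟩ := hy
    induction hg using Submonoid.closure_induction with
    | mem z hz =>
      obtain ⟨m, hm, rfl⟩ := hz
      simpa using h n hn m hm
    | one => simpa using isCoprime_one_right
    | mul a c _ _ iha ihc => simpa using iha.mul_right ihc
  | one => simpa using isCoprime_one_left
  | mul a c _ _ iha ihc => simpa using iha.mul_left ihc

instance (S : Set ℕ) : Nonempty (PhiStar S) := ⟨⟨1, one_mem _⟩⟩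

/-- Each product has finitely many factors, so finitely many classes suffice; this is the finiteness
behind infinite splittings. -/
theorem exists_dvd_prod_of_mem_closure {σ : Type} (S : σ → Set ℕ) {U : Set ℕ}
    (hU : U ⊆ ⋃ s, S s) {g : ℤ[X]}
    (hg : g ∈ Submonoid.closure ((fun n => cyclotomic n ℤ) '' U)) :
    ∃ (T : Finset σ) (f : ∀ s, PhiStar (S s)), g ∣ ∏ s ∈ T, (f s).1 := by
  classical
  induction hg using Submonoid.closure_induction with
  | mem y hy =>
    obtain ⟨n, hn, rfl⟩ := hy
    obtain ⟨s, hs⟩ := Set.mem_iUnion.1 (hU hn)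
    let y : PhiStar (S s) := ⟨cyclotomic n ℤ, Submonoid.subset_closure ⟨n, hs, rfl⟩⟩
    obtain ⟨f, hf⟩ : ∃ f : ∀ s, PhiStar (S s), f s = y :=
      ⟨Function.update (fun s => Classical.arbitrary _) s y, Function.update_self ..⟩
    exact ⟨{s}, f, by rw [Finset.prod_singleton, hf]⟩
  | one => exact ⟨∅, fun s => Classical.arbitrary _, one_dvd _⟩
  | mul a c _ _ iha ihc =>
    obtain ⟨T, f, hf⟩ := iha
    obtain ⟨T', f', hf'⟩ := ihc
    refine ⟨T ∪ T', fun s => ⟨(f s).1 * (f' s).1, mul_mem (f s).2 (f' s).2⟩, ?_⟩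
    rw [Finset.prod_mul_distrib]
    exact mul_dvd_mul (hf.trans (Finset.prod_dvd_prod_of_subset _ _ _ Finset.subset_union_left))
      (hf'.trans (Finset.prod_dvd_prod_of_subset _ _ _ Finset.subset_union_right))

/-- If `p` is invertible in `R`, then an inverse limit of quotients of `R[q]` by products of
cyclotomic polynomials splits according to the `p`-adic valuation `v` of the indices. -/
theorem pi_completion_bijective {p : ℕ} (hp : p.Prime) (hpu : IsUnit (p : R)) {σ : Type}
    (S : σ → Set ℕ) {v : σ → ℕ} (hv : Function.Injective v)
    (hS : ∀ s, ∀ n ∈ S s, 0 < n ∧ padicValNat p n = v s) {U : Set ℕ} (hU : U ⊆ ⋃ s, S s)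
    {ι : Type} [Preorder ι] [IsDirectedOrder ι] [Nonempty ι] {I : ι → Ideal R[X]}
    (hI : Antitone I) (h : ∀ s f, ∃ i, I i ≤ phiIdeal R (S s) f)
    (hcof : ∀ i, ∃ f, phiIdeal R U f ≤ I i) :
    Function.Bijective
      (RingHom.pi fun s => invLimMap hI (phiIdeal_antitone R (S s)) (h s)) := by
  have hcop (s t : σ) (hst : s ≠ t) (f : PhiStar (S s)) (g : PhiStar (S t)) :
      IsCoprime (f.1.map (Int.castRingHom R)) (g.1.map (Int.castRingHom R)) :=
    isCoprime_map_of_mem_closure (fun n hn m hm =>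
      isCoprime_cyclotomic_of_padicValNat_ne hp hpu (hS s n hn).1 (hS t m hm).1 (by
        rw [(hS s n hn).2, (hS t m hm).2]
        exact hv.ne hst)) f.2 g.2
  refine pi_invLimMap_bijective hI (fun s => phiIdeal_antitone R (S s)) h
    (fun s t hst f g => (Ideal.isCoprime_span_singleton_iff _ _).2 (hcop s t hst f g)) fun i => ?_
  obtain ⟨g, hg⟩ := hcof i
  obtain ⟨T, f, hf⟩ := exists_dvd_prod_of_mem_closure S hU g.2
  refine ⟨T, f, le_trans (le_of_eq ?_) (le_trans (Ideal.span_singleton_le_span_singleton.2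
    (Polynomial.map_dvd (Int.castRingHom R) hf)) hg)⟩
  rw [Polynomial.map_prod]
  -- For pairwise coprime generators the intersection of the principal ideals is generated by the
  -- product.
  exact Ideal.finset_inf_span_singleton _ _ fun s _ t _ hst => hcop s t hst _ _

theorem X_pow_sub_one_mem_closure {n : ℕ} (hn : 0 < n) {S : Set ℕ} (h : ∀ d, d ∣ n → d ∈ S) :
    (X ^ n - 1 : ℤ[X]) ∈ Submonoid.closure ((fun n => cyclotomic n ℤ) '' S) := by
  rw [← prod_cyclotomic_eq_X_pow_sub_one hn]
  exact Submonoid.prod_mem _ fun d hd =>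
    Submonoid.subset_closure ⟨d, h d (Nat.dvd_of_mem_divisors hd), rfl⟩

theorem associated_qPoch_X_X (k : ℕ) :
    Associated (qPoch (X : R[X]) X k) (∏ j ∈ Finset.range k, (X ^ (j + 1) - 1)) :=
  Associated.prod _ _ _ fun j _ => ⟨-1, by rw [pow_succ']; simp⟩

theorem exists_phiIdeal_le_sIdeal (R : Type) [CommRing R] (k : ℕ) :
    ∃ f, phiIdeal R (coprimeTo 1) f ≤ sIdeal R k := by
  refine ⟨⟨∏ j ∈ Finset.range k, (X ^ (j + 1) - 1), Submonoid.prod_mem _ fun j _ =>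
    X_pow_sub_one_mem_closure j.succ_pos fun d hd =>
      ⟨Nat.pos_of_dvd_of_pos hd j.succ_pos, Nat.coprime_one_left d⟩⟩,
    Ideal.span_singleton_le_span_singleton.2 ?_⟩
  simpa [Polynomial.map_prod] using (associated_qPoch_X_X (R := R) k).dvd

end Cyclotomic

/-! ### 2-adic separatedness and injectivity of `𝒮_b → ℛ_b` -/

section Separated

variable {A : Type} [CommRing A]

/-- Taking remainders modulo a monic `g` is `A`-linear, so each coefficient of the remainder of `a`
is divisible by every power of `c`. -/
theorem dvd_of_forall_dvd_sub_pow_mul {g a : A[X]} (hg : g.Monic) {c : A}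
    (hc : ∀ z : A, (∀ s : ℕ, c ^ s ∣ z) → z = 0) (h : ∀ s : ℕ, ∃ e, g ∣ a - C (c ^ s) * e) :
    g ∣ a := by
  rw [← modByMonic_eq_zero_iff_dvd hg]
  ext i
  refine hc _ fun s => ?_
  obtain ⟨e, he⟩ := h s
  rw [← modByMonic_eq_zero_iff_dvd hg, sub_modByMonic, sub_eq_zero] at he
  rw [he, ← smul_eq_C_mul, smul_modByMonic, coeff_smul, smul_eq_mul]
  exact dvd_mul_right _ _

/-- After clearing denominators, which are odd, an integer numerator is divisible by every power of
2. -/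
theorem eq_zero_of_forall_two_pow_dvd {b : ℕ} (hb : Odd b) (z : ZInv b)
    (h : ∀ s : ℕ, (2 : ZInv b) ^ s ∣ z) : z = 0 := by
  have hb0 : (b : ℤ) ≠ 0 := by exact_mod_cast hb.pos.ne'
  have hle : Submonoid.powers (b : ℤ) ≤ nonZeroDivisors ℤ :=
    powers_le_nonZeroDivisors_of_noZeroDivisors hb0
  have inj : Function.Injective (algebraMap ℤ (ZInv b)) := IsLocalization.injective _ hle
  obtain ⟨⟨w, y⟩, hw⟩ := IsLocalization.surj (Submonoid.powers (b : ℤ)) z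
  have hw0 : w = 0 := by
    by_contra hne
    obtain ⟨s, hs⟩ := (Int.finiteMultiplicity_iff.2 ⟨by decide, hne⟩ : FiniteMultiplicity (2 : ℤ) w)
    apply hs
    obtain ⟨e, he⟩ := h (s + 1)
    obtain ⟨⟨u, ⟨_, t, rfl⟩⟩, hu⟩ := IsLocalization.surj (Submonoid.powers (b : ℤ)) (e * algebraMap ℤ _ y.1)
    have key : w * (b : ℤ) ^ t = 2 ^ (s + 1) * u := by
      apply inj
      simp only at hu hw
      rw [map_mul, ← hw, map_mul, ← hu, he]
      simp
      ring
    have hcop : IsCoprime ((2 : ℤ) ^ (s + 1)) ((b : ℤ) ^ t) := by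
      apply IsCoprime.pow
      exact_mod_cast Nat.isCoprime_iff_coprime.2 (Nat.coprime_two_left.2 hb)
    exact hcop.dvd_of_dvd_mul_right ⟨u, key⟩
  rw [hw0, map_zero] at hw
  exact (IsLocalization.map_units (ZInv b) y).mul_left_eq_zero.1 hw

/-- Modulo 2, `1 - X ^ (2m)` is `(1 - X ^ m) ^ 2`, which reduces to odd `n`; then `X ^ n - 1` has
only odd-index cyclotomic factors, and the sign is invisible modulo 2. -/
theorem exists_phiStar_two_dvd_one_sub_X_pow_sub (n : ℕ) (hn : 0 < n) :
    ∃ h : PhiStar (coprimeTo 2), (2 : ℤ[X]) ∣ 1 - X ^ n - h.1 := by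
  induction n using Nat.strong_induction_on with
  | _ n ih =>
    rcases n.even_or_odd' with ⟨m, rfl | rfl⟩
    · obtain ⟨h, c, hc⟩ := ih m (by omega) (by omega)
      refine ⟨⟨h.1 * h.1, mul_mem h.2 h.2⟩, ?_⟩
      have : h.1 = 1 - X ^ m - 2 * c := by rw [← hc]; ring
      exact ⟨X ^ m - X ^ m * X ^ m + 2 * c * (1 - X ^ m) - 2 * c * c, by
        simp only [this]; ring⟩
    · refine ⟨⟨X ^ (2 * m + 1) - 1, X_pow_sub_one_mem_closure hn fun d hd =>
        ⟨Nat.pos_of_dvd_of_pos hd hn, Nat.coprime_two_left.2 (Odd.of_dvd_nat ⟨m, rfl⟩ hd)⟩⟩,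
        1 - X ^ (2 * m + 1), ?_⟩
      ring

theorem exists_phiStar_two_dvd_qPoch_sub (k : ℕ) :
    ∃ h : PhiStar (coprimeTo 2), (2 : ℤ[X]) ∣ qPoch X X k - h.1 := by
  induction k with
  | zero => exact ⟨⟨1, one_mem _⟩, by simp [qPoch]⟩
  | succ k ih =>
    obtain ⟨h, c, hc⟩ := ih
    obtain ⟨h', c', hc'⟩ := exists_phiStar_two_dvd_one_sub_X_pow_sub (k + 1) k.succ_pos
    refine ⟨⟨h.1 * h'.1, mul_mem h.2 h'.2⟩, c * (1 - X ^ (k + 1)) + h.1 * c', ?_⟩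
    rw [show qPoch (X : ℤ[X]) X (k + 1) = qPoch X X k * (1 - X ^ (k + 1)) by
      rw [qPoch, Finset.prod_range_succ, ← pow_succ']; rfl]
    linear_combination (1 - X ^ (k + 1)) * hc + h.1 * hc'

theorem sToR_injective {b : ℕ} (hb : Odd b) : Function.Injective (sToR b) := by
  rw [injective_iff_map_eq_zero]
  intro x hx
  ext k
  obtain ⟨h, c, hc⟩ := exists_phiStar_two_dvd_qPoch_sub k
  obtain ⟨a, ha⟩ := Ideal.Quotient.mk_surjective (x.1 k)
  rw [← ha]
  -- Division with remainder needs a monic divisor, so `(q; q)_k` is replaced by its associate `∏ (X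
  -- ^ (j + 1) - 1)`.
  refine Ideal.Quotient.eq_zero_iff_mem.2 (Ideal.mem_span_singleton.2
    ((associated_qPoch_X_X k).dvd.trans ?_))
  refine dvd_of_forall_dvd_sub_pow_mul (c := 2) (monic_prod_of_monic _ _ fun j _ => by
    simpa using monic_X_pow_sub_C (1 : ZInv b) j.succ_ne_zero)
    (eq_zero_of_forall_two_pow_dvd hb) fun s => ?_
  obtain ⟨l, hl⟩ := exists_rIdeal_le (ZInv b) (coprimeTo 2)
    (fun n hn => Nat.coprime_two_left.1 hn.2) ⟨h.1 ^ s, pow_mem h.2 s⟩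
  obtain ⟨m, hm⟩ := exists_sIdeal_le_rIdeal (ZInv b) l
  obtain ⟨a', ha'⟩ := exists_forall_mk_eq x {k, m}
  have h1 : (sToR b x).1 l = 0 := by rw [hx]; rfl
  rw [sToR, invLimMap_apply _ _ _ _ hm, ha' m (by simp), Ideal.Quotient.factor_mk,
    Ideal.Quotient.eq_zero_iff_mem] at h1
  obtain ⟨e, he⟩ := Ideal.mem_span_singleton.1 (hl h1)
  have h2 := ha' k (by simp)
  rw [← ha, Ideal.Quotient.eq] at h2
  have h3 := Ideal.mem_span_singleton.1 h2
  have h4 : qPoch X X k = h.1.map (Int.castRingHom (ZInv b)) +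
      2 * c.map (Int.castRingHom (ZInv b)) := by
    have := congrArg (Polynomial.map (Int.castRingHom (ZInv b))) hc
    simp only [qPoch, Polynomial.map_sub, Polynomial.map_prod, Polynomial.map_mul,
      Polynomial.map_pow, Polynomial.map_X, Polynomial.map_one, Polynomial.map_ofNat] at this ⊢
    rw [← this]
    ring
  have h5 : qPoch (X : (ZInv b)[X]) X k ∣ h.1.map (Int.castRingHom (ZInv b)) ^ s -
      (-2 * c.map (Int.castRingHom (ZInv b))) ^ s := by
    rw [show qPoch (X : (ZInv b)[X]) X k = h.1.map (Int.castRingHom (ZInv b)) -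
      -2 * c.map (Int.castRingHom (ZInv b)) by rw [h4]; ring]
    exact sub_dvd_pow_sub_pow (h.1.map (Int.castRingHom (ZInv b)))
      (-2 * c.map (Int.castRingHom (ZInv b))) s
  -- Modulo `(q; q)_k`: `a ≡ a' = h ^ s * e`, and `h ≡ -2c` gives `h ^ s ≡ 2 ^ s * (-c) ^ s`.
  refine ⟨(-c.map (Int.castRingHom (ZInv b))) ^ s * e, (associated_qPoch_X_X k).symm.dvd.trans ?_⟩
  have h6 : a - C ((2 : ZInv b) ^ s) * ((-c.map (Int.castRingHom (ZInv b))) ^ s * e) =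
      (a - a') + (h.1.map (Int.castRingHom (ZInv b)) ^ s -
      (-2 * c.map (Int.castRingHom (ZInv b))) ^ s) * e := by
    simp only [Polynomial.map_pow] at he
    rw [he, show (-2 * c.map (Int.castRingHom (ZInv b))) = 2 * -c.map (Int.castRingHom (ZInv b)) by
      ring, mul_pow, C_pow]
    simp only [map_ofNat]
    ring
  rw [h6]
  exact dvd_add h3 (h5.mul_right e)

end Separated

/-! ### Splitting by `p`-adic valuation -/

section Splitting

theorem isUnit_natCast_zInv {p b : ℕ} (h : p ∣ b) : IsUnit (p : ZInv b) := by
  have : IsUnit ((b : ℕ) : ZInv b) := by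
    simpa using IsLocalization.Away.algebraMap_isUnit (S := ZInv b) (b : ℤ)
  exact isUnit_of_dvd_unit (Nat.cast_dvd_cast h) this

theorem dilate_pow_zero (p : ℕ) (S : Set ℕ) : dilate (p ^ 0) S = S := by
  simp [dilate]

theorem padicValNat_of_mem_dilate {p a j n : ℕ} (hp : p.Prime) (ha : p ∣ a)
    (h : n ∈ dilate (p ^ j) (coprimeTo a)) : 0 < n ∧ padicValNat p n = j := by
  have := Fact.mk hp
  obtain ⟨m, ⟨hm, hcop⟩, rfl⟩ := h
  refine ⟨Nat.mul_pos (pow_pos hp.pos _) hm, ?_⟩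
  rw [padicValNat.mul (pow_pos hp.pos _).ne' hm.ne', padicValNat.prime_pow,
    padicValNat.eq_zero_of_not_dvd, add_zero]
  exact (hp.coprime_iff_not_dvd).1 (hcop.coprime_dvd_left ha)

theorem exists_mem_dilate {p a n : ℕ} (hp : p.Prime) (hn : n ∈ coprimeTo a) :
    ∃ j, n ∈ dilate (p ^ j) (coprimeTo (a * p)) := by
  obtain ⟨j, m, hm, rfl⟩ := Nat.exists_eq_pow_mul_and_not_dvd hn.1.ne' p hp.ne_one
  exact ⟨j, m, ⟨Nat.pos_of_mul_pos_left hn.1, Nat.Coprime.mul_left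
    (hn.2.coprime_mul_left_right) ((hp.coprime_iff_not_dvd).2 hm)⟩, rfl⟩

/-- The sets `ℕ_a` and `p ^ j ℕ_a`, `j > 0`, as one family. -/
def splitFamily (p a : ℕ) (s : Option ℕ+) : Set ℕ :=
  s.elim (coprimeTo a) fun j => dilate (p ^ (j : ℕ)) (coprimeTo a)

theorem splitFamily_eq (p a : ℕ) (s : Option ℕ+) :
    splitFamily p a s = dilate (p ^ s.elim 0 PNat.val) (coprimeTo a) := by
  cases s with
  | none => exact (dilate_pow_zero p _).symm
  | some j => rfl

theorem option_elim_val_injective :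
    Function.Injective fun s : Option ℕ+ => s.elim 0 PNat.val := by
  rintro (_ | i) (_ | j) h
  · rfl
  · exact absurd h.symm j.ne_zero
  · exact absurd h i.ne_zero
  · exact congrArg some (PNat.coe_injective h)

/-- Used with `a = 1` for `𝒮_b` and `a = 2` for `ℛ_b`. -/
theorem subset_iUnion_splitFamily {p : ℕ} (a : ℕ) (hp : p.Prime) :
    coprimeTo a ⊆ ⋃ s, splitFamily p (a * p) s := by
  intro n hn
  obtain ⟨j, hj⟩ := exists_mem_dilate hp hn
  refine Set.mem_iUnion.2 ⟨if h : 0 < j then some ⟨j, h⟩ else none, ?_⟩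
  rw [splitFamily_eq]
  split_ifs with h
  · exact hj
  · obtain rfl : j = 0 := by omega
    exact hj

/-- The factor of valuation 0 stands apart from the product over `j > 0`; indexing by `Option` makes
them one family. -/
theorem prod_bijective_of_pi_bijective {B τ : Type} [CommRing B] {D : Option τ → Type}
    [∀ s, CommRing (D s)] (φ : ∀ s, B →+* D s) (h : Function.Bijective (RingHom.pi φ)) :
    Function.Bijective ((φ none).prod (RingHom.pi fun j => φ (some j))) := by
  constructor
  · intro x y hxy
    refine h.1 (funext fun s => ?_)
    cases s with
    | none => exact congrArg Prod.fst hxy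
    | some j => exact congrFun (congrArg Prod.snd hxy) j
  · rintro ⟨y, z⟩
    obtain ⟨x, hx⟩ := h.2 (fun s => match s with
      | none => y
      | some j => z j)
    exact ⟨x, Prod.ext (congrFun hx none) (funext fun j => congrFun hx (some j))⟩

theorem piSZero_prod_piSBar_bijective {b p : ℕ} (hp : p.Prime) (hpb : p ∣ b) :
    Function.Bijective ((piSZero b p).prod (piSBar b p)) := by
  refine prod_bijective_of_pi_bijective (fun s => sToCompletion b (splitFamily p p s)) ?_
  exact pi_completion_bijective hp (isUnit_natCast_zInv hpb) (splitFamily p p)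
    option_elim_val_injective (fun s n hn => padicValNat_of_mem_dilate hp dvd_rfl
      (by rwa [← splitFamily_eq]))
    (by simpa using subset_iUnion_splitFamily 1 hp) (sIdeal_antitone _) _
    (exists_phiIdeal_le_sIdeal _)

theorem pi_piSComp_bijective {p : ℕ} (hp : p.Prime) :
    Function.Bijective (RingHom.pi (piSComp p)) :=
  pi_completion_bijective hp (isUnit_natCast_zInv dvd_rfl) (fun j => dilate (p ^ j) (coprimeTo p))
    (v := id) Function.injective_id (fun _ _ hn => padicValNat_of_mem_dilate hp dvd_rfl hn)
    (fun _ hn => Set.mem_iUnion.2 (by simpa using exists_mem_dilate hp hn)) (sIdeal_antitone _) _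
    (exists_phiIdeal_le_sIdeal _)

theorem piRZero_prod_piRBar_bijective {b p : ℕ} (ho : Odd p) (hp : p.Prime) (hpb : p ∣ b) :
    Function.Bijective ((piRZero b p).prod (piRBar b p ho)) := by
  refine prod_bijective_of_pi_bijective (fun s => rToCompletion b (splitFamily p (2 * p) s)
    (by
      cases s with
      | none => exact fun _ => odd_of_mem_coprimeTo_two_mul
      | some j => exact fun _ => odd_of_mem_dilate ho)) ?_
  exact pi_completion_bijective hp (isUnit_natCast_zInv hpb) (splitFamily p (2 * p))
    option_elim_val_injective (fun s n hn => padicValNat_of_mem_dilate hp (Dvd.intro_left 2 rfl)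
      (by rwa [← splitFamily_eq]))
    (subset_iUnion_splitFamily 2 hp) (rIdeal_antitone _) _ (exists_phiIdeal_le_rIdeal _)

theorem coprimeTo_two_mul_two : coprimeTo (2 * 2) = coprimeTo 2 := by
  ext n
  simp only [coprimeTo, Set.mem_ofPred_eq, Nat.coprime_mul_iff_left, and_self]

/-- Since `ℕ_4 = ℕ_2`, the target runs over exactly the odd indices and cofinality suffices. -/
theorem piRZero_two_bijective (b : ℕ) : Function.Bijective (piRZero b 2) :=
  invLimMap_bijective _ _ _ (by
    rw [coprimeTo_two_mul_two]
    exact exists_phiIdeal_le_rIdeal (ZInv b))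

theorem sZeroTwoToR_bijective (b : ℕ) : Function.Bijective (sZeroTwoToR b) :=
  invLimMap_bijective _ _ _ (exists_rIdeal_le (ZInv b) _ fun _ hn => Nat.coprime_two_left.1 hn.2)

end Splitting

end CycComp

theorem mainTheorem10 (b : ℕ) (hb : 0 < b) :
    -- splitting of `𝒮_b` for a prime divisor `p` of `b`
    (∀ p : ℕ, p.Prime → p ∣ b →
      ∃ e : CycComp.SRing b ≃+* CycComp.SZero b p × CycComp.SBar b p,
        ∀ x, e x = (CycComp.piSZero b p x, CycComp.piSBar b p x)) ∧
    -- the special case `b = p`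
    (∀ p : ℕ, p.Prime →
      ∃ e : CycComp.SRing p ≃+* (∀ j : ℕ, CycComp.SComp p j),
        ∀ x j, e x j = CycComp.piSComp p j x) ∧
    -- splitting of `ℛ_b` for an odd prime divisor `p` of `b`
    (∀ (p : ℕ) (hp : Odd p), p.Prime → p ∣ b →
      ∃ e : CycComp.RRing b ≃+* CycComp.RZero b p × CycComp.RBar b p,
        ∀ x, e x = (CycComp.piRZero b p x, CycComp.piRBar b p hp x)) ∧
    -- the degenerate case `p = 2`
    (2 ∣ b → Function.Bijective (CycComp.piRZero b 2)) ∧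
    (Odd b → Function.Injective (CycComp.sToR b)) ∧
    (2 ∣ b → Function.Bijective (CycComp.sZeroTwoToR b)) :=
  ⟨fun _ hp hpb => ⟨RingEquiv.ofBijective _ (CycComp.piSZero_prod_piSBar_bijective hp hpb),
      fun _ => rfl⟩,
    fun _ hp => ⟨RingEquiv.ofBijective _ (CycComp.pi_piSComp_bijective hp), fun _ _ => rfl⟩,
    fun _ ho hp hpb => ⟨RingEquiv.ofBijective _
      (CycComp.piRZero_prod_piRBar_bijective ho hp hpb), fun _ => rfl⟩,
    fun _ => CycComp.piRZero_two_bijective b, CycComp.sToR_injective,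
    fun _ => CycComp.sZeroTwoToR_bijective b⟩
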